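/- Let $\mathcal M=(S,A,T,R,\beta,L,\Phi)$ be a finite labeled Markov decision process: $S$ is a finite state set; $A(s)\neq\emptyset$ is the finite set of actions available in state $s$; $T(\cdot\mid s,a)$ is a probability distribution on $S$ for each $s\in S$, $a\in A(s)$; $R(s,a,s')\in\mathbb R$ is a reward, with $R(s,a):=\sum_{s'}T(s'\mid s,a)R(s,a,s')$; $\beta$ is the initial distribution on $S$; and $\Phi=\{(L_i,[l_i,u_i])\}_{i=1}^{n_L}$ with $L_i\subseteq S$ and $l_i,u_i\in\mathbb R$. A stationary policy $\pi$ assigns to each $s$ a probability distribution $\pi(\cdot\mid s)$ on $A(s)$. It induces the Markov chain $\mathcal M_\pi$ with initial distribution $\beta$ and transition function $T_\pi(s'\mid s)=\sum_{a\in A(s)}T(s'\mid s,a)\pi(a\mid s)$. The transition graph of $\mathcal M$ has an edge $s\to s'$ iff $T(s'\mid s,a)>0$ for some $a\in A(s)$; that of $\mathcal M_\pi$ has an edge $s\to s'$ iff $T_\pi(s'\mid s)>0$. A terminal strongly connected component (TSCC) is a strongly connected component of the transition graph that is reachable from some state $s$ with $\beta_s>0$ and has no edge leaving it. Let $r(\mathcal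 M)$ and $r(\mathcal M_\pi)$ be the unions of the TSCCs of $\mathcal M$ and of $\mathcal M_\pi$, and $\bar r(\mathcal M)=S\setminus r(\mathcal M)$. The set of edge-preserving policies is $$\Pi_{EP}=\{\pi \text{ stationary}:\ r(\mathcal M_\pi)=r(\mathcal M)\ \text{and}\ \pi(a\mid s)>0\ \ \forall s\in r(\mathcal M),\,a\in A(s)\}.$$ With $S_0\sim\beta$ and $(S_t,A_t)$ the state and action at time $t$ under $\pi$, let $$\mathrm{Pr}^\infty_\pi(s,a)=\lim_{n\to\infty}\tfrac1n\sum_{t=1}^n\Pr(S_t=s,A_t=a),\qquad R^\infty_\pi(\beta)=\liminf_{n\to\infty}\tfrac1n\sum_{t=1}^n\mathbb E[R(S_t,A_t)].$$ The policy $\pi$ meets the specifications $\Phi$ if the limits $\mathrm{Pr}^\infty_\pi(s,a)$ exist and $l_i\le\sum_{s\in L_i}\sum_{a\in A(s)}\mathrm{Pr}^\infty_\pi(s,a)\le u_i$ for all $i$. Let $\mathrm{LP}_1$ be the program of maximizing $\sum_{s\in S}\sum_{a\in A(s)}x_{sa}R(s,a)$ over real $(x_{sa},y_{sa})_{s\in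 S,a\in A(s)}$ subject to 1. $\sum_{s}\sum_{a\in A(s)}x_{sa}T(s'\mid s,a)=\sum_{a\in A(s')}x_{s'a}$ for all $s'\in S$; 2. $\sum_{s}\sum_{a\in A(s)}y_{sa}T(s'\mid s,a)=\sum_{a\in A(s')}(x_{s'a}+y_{s'a})-\beta_{s'}$ for all $s'\in S$; 3. $\sum_{f\in\bar r(\mathcal M)}\sum_{a\in A(f)}x_{fa}=0$; 4. $l_i\le\sum_{s\in L_i}\sum_{a\in A(s)}x_{sa}\le u_i$ for all $i$; 5. $x_{sa}>0$ for all $s\in r(\mathcal M)$, $a\in A(s)$; 6. $x_{sa}\in[0,1]$ and $y_{sa}\ge0$ for all $s\in S$, $a\in A(s)$. For feasible $(x,y)$ put $x_s=\sum_{a\in A(s)}x_{sa}$, $y_s=\sum_{a\in A(s)}y_{sa}$, and let $\pi(x,y)$ be any stationary policy with $\pi(a\mid s)=x_{sa}/x_s$ if $x_s>0$, and $\pi(a\mid s)=y_{sa}/y_s$ if $x_s=0<y_s$ (it is arbitrary at the other states). **Theorem.** $\mathrm{LP}_1$ is feasible if and only if there is a policy $\pi\in\Pi_{EP}$ that meets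 the specifications $\Phi$. Further, if $(x^*,y^*)$ is an optimal solution of $\mathrm{LP}_1$, then (for every choice at the arbitrary states) the policy $\pi^*=\pi(x^*,y^*)$ belongs to $\Pi_{EP}$, meets the specifications $\Phi$, and satisfies $R^\infty_{\pi^*}(\beta)\ge R^\infty_\pi(\beta)$ for every $\pi\in\Pi_{EP}$ that meets the specifications $\Phi$. -/

import Mathlib

open Filter Topology

noncomputable section

/-! ## Directed graphs and terminal strongly connected components -/

/-- `C` is a strongly connected component of the digraph with edge relation `E`: a maximal set of
vertices any two of which are joined by a directed path (in both directions, since the pair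
`(s, s')` ranges over all ordered pairs; the path from a vertex to itself may have length zero). -/
def IsSCC {S : Type*} (E : S → S → Prop) (C : Set S) : Prop :=
  Maximal (fun D : Set S => ∀ s ∈ D, ∀ s' ∈ D, Relation.ReflTransGen E s s') C

/-- `C` is a terminal strongly connected component of the digraph `E` with initial distribution
`β`: an SCC that is reachable from some state of positive initial probability and that has no
edge to a vertex outside it. -/
def IsTSCC {S : Type*} (E : S → S → Prop) (β : S → ℝ) (C : Set S) : Prop :=
  IsSCC E C ∧
  (∃ s₀, 0 < β s₀ ∧ ∃ s ∈ C, Relation.ReflTransGen E s₀ s) ∧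
  (∀ s ∈ C, ∀ s' ∉ C, ¬ E s s')

/-- The union of all terminal strongly connected components. -/
def tsccUnion {S : Type*} (E : S → S → Prop) (β : S → ℝ) : Set S :=
  {s | ∃ C, IsTSCC E β C ∧ s ∈ C}

/-! ## Labeled Markov decision processes -/

/-- A finite Markov decision process with state space `S`, action set `A`, sets of available
actions `avail s`, transition function `T s a s'` (the probability of moving from `s` to `s'`
under `a`), reward `R s a s'` and initial distribution `β`. -/
structure MDP (S A : Type*) [Fintype S] where
  avail : S → Finset A
  avail_nonempty : ∀ s, (avail s).Nonempty
  T : S → A → S → ℝ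
  T_nonneg : ∀ s, ∀ a ∈ avail s, ∀ s', 0 ≤ T s a s'
  T_sum : ∀ s, ∀ a ∈ avail s, ∑ s', T s a s' = 1
  R : S → A → S → ℝ
  β : S → ℝ
  β_nonneg : ∀ s, 0 ≤ β s
  β_sum : ∑ s, β s = 1

/-- A labeled MDP: an MDP with labels `label i ⊆ S` and steady-state specifications
`(label i, [lo i, hi i])`. -/
structure LMDP (S A : Type*) [Fintype S] extends MDP S A where
  numLabels : ℕ
  label : Fin numLabels → Finset S
  lo : Fin numLabels → ℝ
  hi : Fin numLabels → ℝ

namespace MDP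

variable {S A : Type*} [Fintype S] (M : MDP S A)

/-- The edges of the transition graph of the MDP. -/
def Edge (s s' : S) : Prop := ∃ a ∈ M.avail s, 0 < M.T s a s'

/-- The union of the TSCCs of the MDP. -/
def recurrentSet : Set S := tsccUnion M.Edge M.β

/-- The expected one-step reward `R(s,a) = ∑ s', T(s'|s,a) R(s,a,s')`. -/
def meanReward (s : S) (a : A) : ℝ := ∑ s', M.T s a s' * M.R s a s'

/-! ### Stationary policies -/

/-- The set of stationary policies: `π s a` is the conditional probability of playing `a` in `s`,
and `π s` is a probability distribution on the actions that are available in `s`. -/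
def stationaryPolicies : Set (S → A → ℝ) :=
  {π | ∀ s, (∀ a, 0 ≤ π s a) ∧ (∀ a ∉ M.avail s, π s a = 0) ∧ ∑ a ∈ M.avail s, π s a = 1}

/-- The transition function `T_π(s'|s)` of the Markov chain induced by the policy `π`. -/
def inducedT (π : S → A → ℝ) (s s' : S) : ℝ := ∑ a ∈ M.avail s, M.T s a s' * π s a

/-- The edges of the transition graph of the induced Markov chain. -/
def inducedEdge (π : S → A → ℝ) (s s' : S) : Prop := 0 < M.inducedT π s s'

/-- The union of the TSCCs of the induced Markov chain. -/
def inducedRecurrentSet (π : S → A → ℝ) : Set S := tsccUnion (M.inducedEdge π) M.β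

/-- The edge-preserving policies. -/
def edgePreserving : Set (S → A → ℝ) :=
  {π | π ∈ M.stationaryPolicies ∧ M.inducedRecurrentSet π = M.recurrentSet ∧
    ∀ s ∈ M.recurrentSet, ∀ a ∈ M.avail s, 0 < π s a}

/-! ### Long-run behaviour of a policy -/

/-- The law of the state `S_t` of the process started from `β` and controlled by `π`. -/
def stateProb (π : S → A → ℝ) : ℕ → S → ℝ
  | 0 => M.β
  | t + 1 => fun s' => ∑ s, stateProb π t s * M.inducedT π s s'

/-- The joint law of the state and the action at time `t`: `Pr(S_t = s, A_t = a | β, π)`. -/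
def stateActionProb (π : S → A → ℝ) (t : ℕ) (s : S) (a : A) : ℝ := M.stateProb π t s * π s a

/-- `p` is the steady-state distribution of `π` on the available state-action pairs: the limit of
`(1/n) ∑_{t=1}^n Pr(S_t = s, A_t = a | β, π)` exists and equals `p s a`. -/
def IsSteadyState (π p : S → A → ℝ) : Prop :=
  ∀ s, ∀ a ∈ M.avail s,
    Tendsto (fun n : ℕ => (1 / (n : ℝ)) * ∑ t ∈ Finset.Icc 1 n, M.stateActionProb π t s a)
      atTop (𝓝 (p s a))

/-- The expectation of `R(S_t, A_t)`. -/
def expectedReward (π : S → A → ℝ) (t : ℕ) : ℝ :=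
  ∑ s, ∑ a ∈ M.avail s, M.stateActionProb π t s a * M.meanReward s a

/-- The expected average reward of `π`. -/
def averageReward (π : S → A → ℝ) : ℝ :=
  liminf (fun n : ℕ => (1 / (n : ℝ)) * ∑ t ∈ Finset.Icc 1 n, M.expectedReward π t) atTop

/-! ### The linear program and the policy derived from its solutions -/

open Classical in
/-- The constraint set `Q₀`. -/
structure IsQ0 (x y : S → A → ℝ) : Prop where
  stationary : ∀ s', ∑ s, ∑ a ∈ M.avail s, x s a * M.T s a s' = ∑ a ∈ M.avail s', x s' a
  flow : ∀ s', ∑ s, ∑ a ∈ M.avail s, y s a * M.T s a s' =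
    ∑ a ∈ M.avail s', (x s' a + y s' a) - M.β s'
  transient : ∑ f ∈ Finset.univ.filter (fun f => f ∉ M.recurrentSet), ∑ a ∈ M.avail f, x f a = 0
  x_mem : ∀ s, ∀ a ∈ M.avail s, x s a ∈ Set.Icc (0 : ℝ) 1
  y_nonneg : ∀ s, ∀ a ∈ M.avail s, 0 ≤ y s a

/-- The objective function of the linear program. -/
def lpObjective (x : S → A → ℝ) : ℝ := ∑ s, ∑ a ∈ M.avail s, x s a * M.meanReward s a

open Classical in
/-- The policy `π(x, y)`: it is `x_{sa} / x_s` where `x_s > 0`, else `y_{sa} / y_s` where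
`y_s > 0`, and it agrees with the policy `π₀` at all the other states (where the
choice is arbitrary). -/
def lpPolicy (x y π₀ : S → A → ℝ) (s : S) (a : A) : ℝ :=
  if a ∈ M.avail s then
    if 0 < ∑ b ∈ M.avail s, x s b then x s a / ∑ b ∈ M.avail s, x s b
    else if 0 < ∑ b ∈ M.avail s, y s b then y s a / ∑ b ∈ M.avail s, y s b
    else π₀ s a
  else 0

end MDP

namespace LMDP

variable {S A : Type*} [Fintype S] (M : LMDP S A)

/-- The Markov chain induced by `π` satisfies all the steady-state specifications. -/
def MeetsSpecs (π : S → A → ℝ) : Prop :=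
  ∃ p, M.IsSteadyState π p ∧
    ∀ i, ∑ s ∈ M.label i, ∑ a ∈ M.avail s, p s a ∈ Set.Icc (M.lo i) (M.hi i)

/-- The feasible solutions of `LP₁`. -/
structure IsLP1Feasible (x y : S → A → ℝ) : Prop where
  q0 : M.IsQ0 x y
  specs : ∀ i, ∑ s ∈ M.label i, ∑ a ∈ M.avail s, x s a ∈ Set.Icc (M.lo i) (M.hi i)
  pos : ∀ s ∈ M.recurrentSet, ∀ a ∈ M.avail s, 0 < x s a

/-- The optimal solutions of `LP₁`. -/
def IsLP1Optimal (x y : S → A → ℝ) : Prop :=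
  M.IsLP1Feasible x y ∧ ∀ x' y', M.IsLP1Feasible x' y' → M.lpObjective x' ≤ M.lpObjective x

end LMDP

end

/-! ## Strongly connected components and reachability -/

/-! Write `K` for the kernel induced by a policy. The mean ergodic theorem (`exists_decomposition`,
`tendsto_average`) splits `β = x + (w - wK)` with `xK = x`; then `x` is the limit of the averages of
`βKᵗ`, and its support is the union of the TSCCs (`limit_pos_iff`).

For an edge-preserving policy, `x s * π s a` and `y s * π s a` satisfy the constraints as soon as
the Poisson solution `w` is replaced by a nonnegative one `y` (`exists_nonneg_poisson`).

Conversely, the state marginal `X` of a feasible `x` is invariant under the derived policy. The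
obstacle is the flow constraint: on recurrent states the policy follows `x`, not `y`, so the
marginal of `y` need not solve the Poisson equation. However, `K`-harmonic functions are constant on
recurrent classes, so every action available there preserves their value, and the flow constraint
makes `β - X` orthogonal to all of them. By duality (`exists_poisson_of_orthogonal`) some other `w`
solves `β - X = w - wK`, which identifies `X` as the limit. Objective values are thus average
rewards, and optimality transfers. -/

/-- The union of the TSCCs consists of the reachable states that can be reached back from every
state they lead to. -/
theorem mem_tsccUnion_iff {S : Type*} {E : S → S → Prop} {β : S → ℝ} {s : S} :
    s ∈ tsccUnion E β ↔ (∃ s₀, 0 < β s₀ ∧ Relation.ReflTransGen E s₀ s) ∧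
      ∀ u, Relation.ReflTransGen E s u → Relation.ReflTransGen E u s := by
  constructor
  · rintro ⟨C, ⟨hC, ⟨s₀, h₀, c, hc, hr⟩, hcl⟩, hs⟩
    refine ⟨⟨s₀, h₀, hr.trans (hC.prop c hc s hs)⟩, fun u hu => ?_⟩
    have huC : u ∈ C := by
      induction hu with
      | refl => exact hs
      | tail _ h ih => exact by_contra fun hn => hcl _ ih _ hn h
    exact hC.prop u huC s hs
  · rintro ⟨⟨s₀, h₀, hr⟩, hback⟩
    -- The component is the forward orbit of `s`; `hback` makes it strongly connected.
    refine ⟨{u | Relation.ReflTransGen E s u}, ⟨⟨?_, ?_⟩, ⟨s₀, h₀, s, .refl, hr⟩, ?_⟩, .refl⟩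
    · exact fun u hu v hv => (hback u hu).trans hv
    · exact fun D hD hle d hd => hD s (hle .refl) d hd
    · exact fun u hu v hv h => hv (Relation.ReflTransGen.tail hu h)

theorem mem_tsccUnion_of_reflTransGen {S : Type*} {E : S → S → Prop} {β : S → ℝ} {s u : S}
    (hs : s ∈ tsccUnion E β) (hu : Relation.ReflTransGen E s u) : u ∈ tsccUnion E β := by
  rw [mem_tsccUnion_iff] at hs ⊢
  obtain ⟨⟨s₀, h₀, hr⟩, hback⟩ := hs
  exact ⟨⟨s₀, h₀, hr.trans hu⟩, fun v hv => (hback v (hu.trans hv)).trans hu⟩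

/-! ## Finite Markov chains -/

/-- `K` is a stochastic kernel on the finite set `S`. -/
structure IsStochastic {S : Type*} [Fintype S] (K : S → S → ℝ) : Prop where
  nonneg : ∀ s s', 0 ≤ K s s'
  sum_eq : ∀ s, ∑ s', K s s' = 1

/-- The action of the kernel `K` on row vectors. -/
def pushRow {S : Type*} [Fintype S] (K : S → S → ℝ) : (S → ℝ) →ₗ[ℝ] (S → ℝ) where
  toFun v s' := ∑ s, v s * K s s'
  map_add' v w := by ext; simp [add_mul, Finset.sum_add_distrib]
  map_smul' c v := by ext; simp [mul_assoc, Finset.mul_sum]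

theorem pushRow_apply {S : Type*} [Fintype S] (K : S → S → ℝ) (v : S → ℝ) (s' : S) :
    pushRow K v s' = ∑ s, v s * K s s' := rfl

theorem pow_pushRow_of_invariant {S : Type*} [Fintype S] {K : S → S → ℝ} {x : S → ℝ}
    (hx : pushRow K x = x) (t : ℕ) : (pushRow K ^ t) x = x := by
  induction t with
  | zero => rfl
  | succ t ih => rw [pow_succ', Module.End.mul_apply, ih, hx]

namespace IsStochastic

variable {S : Type*} [Fintype S] {K : S → S → ℝ}

/-! ### Convergence of averages -/

theorem sum_abs_pushRow_le (hK : IsStochastic K) (v : S → ℝ) :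
    ∑ s, |pushRow K v s| ≤ ∑ s, |v s| := by
  calc ∑ s', |pushRow K v s'| ≤ ∑ s', ∑ s, |v s| * K s s' := by
        refine Finset.sum_le_sum fun s' _ => ?_
        rw [pushRow_apply]
        refine (Finset.abs_sum_le_sum_abs _ _).trans_eq (Finset.sum_congr rfl fun s _ => ?_)
        rw [abs_mul, abs_of_nonneg (hK.nonneg s s')]
    _ = ∑ s, |v s| := by
        rw [Finset.sum_comm]
        exact Finset.sum_congr rfl fun s _ => by rw [← Finset.mul_sum, hK.sum_eq, mul_one]

theorem abs_pow_pushRow_le (hK : IsStochastic K) (v : S → ℝ) (n : ℕ) (s : S) :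
    |(pushRow K ^ n) v s| ≤ ∑ s, |v s| := by
  have h : ∑ s, |(pushRow K ^ n) v s| ≤ ∑ s, |v s| := by
    induction n with
    | zero => simp
    | succ n ih =>
      rw [pow_succ', Module.End.mul_apply]
      exact (hK.sum_abs_pushRow_le _).trans ih
  exact (Finset.single_le_sum (f := fun s => |(pushRow K ^ n) v s|)
    (fun _ _ => abs_nonneg _) (Finset.mem_univ s)).trans h

theorem sum_pushRow (hK : IsStochastic K) (v : S → ℝ) : ∑ s, pushRow K v s = ∑ s, v s := by
  simp only [pushRow_apply]
  rw [Finset.sum_comm]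
  exact Finset.sum_congr rfl fun s _ => by rw [← Finset.mul_sum, hK.sum_eq, mul_one]

theorem pushRow_nonneg (hK : IsStochastic K) {v : S → ℝ} (hv : ∀ s, 0 ≤ v s) (s : S) :
    0 ≤ pushRow K v s :=
  Finset.sum_nonneg fun u _ => mul_nonneg (hv u) (hK.nonneg u s)

theorem pow_pushRow_nonneg (hK : IsStochastic K) {v : S → ℝ} (hv : ∀ s, 0 ≤ v s) (n : ℕ) (s : S) :
    0 ≤ (pushRow K ^ n) v s := by
  induction n generalizing s with
  | zero => exact hv s
  | succ n ih =>
    rw [pow_succ', Module.End.mul_apply]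
    exact hK.pushRow_nonneg ih s

/-- If `v = x + w - w K` with `x` invariant, then the averages of `v K ^ t` converge to `x`. -/
theorem tendsto_average (hK : IsStochastic K) {v x w : S → ℝ} (hx : pushRow K x = x)
    (hv : v - x = w - pushRow K w) (s : S) :
    Tendsto (fun n : ℕ => (1 / (n : ℝ)) * ∑ t ∈ Finset.Icc 1 n, (pushRow K ^ t) v s)
      atTop (𝓝 (x s)) := by
  -- The orbit is `x` plus a telescoping difference; the remainder stays bounded by ℓ¹ contraction
  -- and vanishes after division by `n`.
  have hvt (t : ℕ) : (pushRow K ^ t) v s =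
      x s + ((pushRow K ^ t) w s - (pushRow K ^ (t + 1)) w s) := by
    have : v = x + (w - pushRow K w) := by rw [← hv]; abel
    rw [this, map_add, map_sub, pow_pushRow_of_invariant hx, pow_succ, Module.End.mul_apply]
    rfl
  have hsum (n : ℕ) : ∑ t ∈ Finset.Icc 1 n, (pushRow K ^ t) v s =
      n * x s + ((pushRow K ^ 1) w s - (pushRow K ^ (n + 1)) w s) := by
    induction n with
    | zero => simp
    | succ n ih =>
      rw [Finset.sum_Icc_succ_top (by omega), ih, hvt]
      push_cast
      ring
  rw [← tendsto_sub_nhds_zero_iff]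
  refine squeeze_zero_norm' (a := fun n : ℕ => (2 * ∑ s, |w s|) / n) ?_
    (tendsto_const_div_atTop_nhds_zero_nat _)
  filter_upwards [eventually_gt_atTop 0] with n hn
  have hn' : (0 : ℝ) < n := by exact_mod_cast hn
  have : (1 / (n : ℝ)) * ∑ t ∈ Finset.Icc 1 n, (pushRow K ^ t) v s - x s =
      ((pushRow K ^ 1) w s - (pushRow K ^ (n + 1)) w s) / n := by
    rw [hsum]
    field_simp
    ring
  rw [this, norm_div, Real.norm_eq_abs, Real.norm_of_nonneg hn'.le]
  gcongr
  have h1 := hK.abs_pow_pushRow_le w 1 s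
  have h2 := hK.abs_pow_pushRow_le w (n + 1) s
  have h3 := abs_sub ((pushRow K ^ 1) w s) ((pushRow K ^ (n + 1)) w s)
  linarith

/-- The averages of the constant orbit of `x` converge both to `x` and to `0`. -/
theorem eq_zero_of_sub_pushRow_invariant (hK : IsStochastic K) {x w : S → ℝ}
    (hx : pushRow K x = x) (hw : x = w - pushRow K w) : x = 0 := by
  ext s
  have h1 := hK.tendsto_average hx (v := x) (w := 0) (by simp) s
  have h2 := hK.tendsto_average (v := x) (x := 0) (w := w) (by simp) (by simpa using hw) s
  exact tendsto_nhds_unique h1 h2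

/-- The mean ergodic decomposition. -/
theorem exists_decomposition (hK : IsStochastic K) (v : S → ℝ) :
    ∃ x w, pushRow K x = x ∧ v - x = w - pushRow K w := by
  set f : (S → ℝ) →ₗ[ℝ] (S → ℝ) := 1 - pushRow K with hf
  -- Kernel and range of `1 - K` meet trivially, so by rank-nullity they span the whole space.
  have hd : Disjoint (LinearMap.ker f) (LinearMap.range f) := by
    rw [Submodule.disjoint_def]
    rintro x hx ⟨w, hw⟩
    refine hK.eq_zero_of_sub_pushRow_invariant (w := w) ?_ (by rw [← hw]; rfl)
    exact (sub_eq_zero.mp (LinearMap.mem_ker.mp hx)).symm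
  have hc : LinearMap.ker f ⊔ LinearMap.range f = ⊤ := by
    refine Submodule.eq_top_of_disjoint _ _ ?_ hd
    rw [add_comm, LinearMap.finrank_range_add_finrank_ker]
  obtain ⟨x, hx, u, ⟨w, rfl⟩, rfl⟩ := Submodule.mem_sup.mp (hc ▸ Submodule.mem_top : v ∈ _)
  refine ⟨x, w, (sub_eq_zero.mp (LinearMap.mem_ker.mp hx)).symm, ?_⟩
  rw [add_sub_cancel_left]
  rfl

/-! ### Harmonic functions, closed sets and recurrence -/

/-- Harmonic functions are constant on recurrent classes. -/
theorem harmonic_eq (hK : IsStochastic K) {h : S → ℝ} (hh : ∀ s, ∑ s', K s s' * h s' = h s) {s : S}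
    (hs : ∀ u, Relation.ReflTransGen (fun s s' => 0 < K s s') s u →
      Relation.ReflTransGen (fun s s' => 0 < K s s') u s)
    {u : S} (hu : Relation.ReflTransGen (fun s s' => 0 < K s s') s u) : h u = h s := by
  -- Maximum principle: `h` keeps its maximal value along every path from a maximizer `m`, and
  -- recurrence of `s` leads from `m` back to `s`.
  obtain ⟨m, hm, hmax⟩ := Set.exists_max_image
    {u | Relation.ReflTransGen (fun s s' => 0 < K s s') s u} h (Set.toFinite _) ⟨s, .refl⟩
  have key : ∀ v, Relation.ReflTransGen (fun s s' => 0 < K s s') m v → h v = h m := by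
    intro v hv
    induction hv with
    | refl => rfl
    | @tail b c hb hbc ih =>
      have h0 : ∑ s', K b s' * (h b - h s') = 0 := by
        simp only [mul_sub, Finset.sum_sub_distrib, ← Finset.sum_mul, hK.sum_eq, hh]
        ring
      have hnn : ∀ s' ∈ Finset.univ, 0 ≤ K b s' * (h b - h s') := by
        intro s' _
        rcases (hK.nonneg b s').eq_or_lt with hz | hp
        · simp [← hz]
        · refine mul_nonneg hp.le ?_
          have := hmax s' (Relation.ReflTransGen.tail (hm.trans hb) hp)
          linarith
      have := (Finset.sum_eq_zero_iff_of_nonneg hnn).mp h0 c (Finset.mem_univ c)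
      rcases mul_eq_zero.mp this with h1 | h1
      · exact absurd h1 hbc.ne'
      · linarith
  rw [key u ((hs m hm).trans hu), key s (hs m hm)]

theorem pos_of_reflTransGen (hK : IsStochastic K) {x : S → ℝ} (hx0 : ∀ s, 0 ≤ x s)
    (hx : pushRow K x = x) {s u : S} (hs : 0 < x s)
    (hu : Relation.ReflTransGen (fun s s' => 0 < K s s') s u) : 0 < x u := by
  induction hu with
  | refl => exact hs
  | @tail b c _ hbc ih =>
    rw [← hx]
    exact Finset.sum_pos' (fun v _ => mul_nonneg (hx0 v) (hK.nonneg v c))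
      ⟨b, Finset.mem_univ b, mul_pos ih hbc⟩

theorem reflTransGen_of_pow_pos (hK : IsStochastic K) {β : S → ℝ} (hβ : ∀ s, 0 ≤ β s) {t : ℕ} {s : S}
    (h : 0 < (pushRow K ^ t) β s) :
    ∃ s₀, 0 < β s₀ ∧ Relation.ReflTransGen (fun s s' => 0 < K s s') s₀ s := by
  induction t generalizing s with
  | zero => exact ⟨s, h, .refl⟩
  | succ t ih =>
    rw [pow_succ', Module.End.mul_apply, pushRow_apply] at h
    obtain ⟨u, -, hu⟩ := Finset.exists_lt_of_sum_lt
      (show ∑ _u : S, (0 : ℝ) < ∑ u, (pushRow K ^ t) β u * K u s by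
        rw [Finset.sum_const_zero]; exact h)
    have hu0 := hK.pow_pushRow_nonneg hβ t u
    have hk0 := hK.nonneg u s
    obtain ⟨s₀, h₀, hr⟩ := ih (pos_of_mul_pos_left hu hk0)
    exact ⟨s₀, h₀, hr.tail (pos_of_mul_pos_right hu hu0)⟩

theorem pow_pos_of_reflTransGen (hK : IsStochastic K) {β : S → ℝ} (hβ : ∀ s, 0 ≤ β s) {s₀ s : S}
    (h₀ : 0 < β s₀) (h : Relation.ReflTransGen (fun s s' => 0 < K s s') s₀ s) :
    ∃ t, 0 < (pushRow K ^ t) β s := by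
  induction h with
  | refl => exact ⟨0, h₀⟩
  | @tail b c _ hbc ih =>
    obtain ⟨t, ht⟩ := ih
    refine ⟨t + 1, ?_⟩
    rw [pow_succ', Module.End.mul_apply]
    exact Finset.sum_pos' (fun v _ => mul_nonneg (hK.pow_pushRow_nonneg hβ t v) (hK.nonneg v c))
      ⟨b, Finset.mem_univ b, mul_pos ht hbc⟩

open Classical in
/-- The mass that `v` puts on a closed set grows by the inflow. -/
theorem sum_pushRow_of_closed (hK : IsStochastic K) (v : S → ℝ)
    {F : Finset S} (hF : ∀ s ∈ F, ∀ s' ∉ F, ¬ 0 < K s s') :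
    ∑ s ∈ F, v s + ∑ s ∈ Fᶜ, v s * ∑ s' ∈ F, K s s' = ∑ s ∈ F, pushRow K v s := by
  simp only [pushRow_apply]
  rw [Finset.sum_comm, ← Finset.sum_add_sum_compl F]
  congr 1
  · refine Finset.sum_congr rfl fun s hs => ?_
    rw [← Finset.mul_sum]
    have h1 := hK.sum_eq s
    rw [← Finset.sum_add_sum_compl F, Finset.sum_eq_zero (s := Fᶜ) (fun s' hs' =>
      le_antisymm (not_lt.mp (hF s hs s' (Finset.mem_compl.mp hs'))) (hK.nonneg s s')),
      add_zero] at h1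
    rw [h1, mul_one]
  · exact Finset.sum_congr rfl fun s _ => Finset.mul_sum _ _ _

/-- States in the support of an invariant vector are recurrent. -/
theorem reflTransGen_symm_of_pos (hK : IsStochastic K) {x : S → ℝ} (hx0 : ∀ s, 0 ≤ x s)
    (hx : pushRow K x = x) {s u : S} (hs : 0 < x s)
    (hu : Relation.ReflTransGen (fun s s' => 0 < K s s') s u) :
    Relation.ReflTransGen (fun s s' => 0 < K s s') u s := by
  classical
  -- The orbit `F` of `u` is closed and invariance fixes its mass, so no charged state outside `F`
  -- has an edge into it. Going backwards along the path from `s` to `u`, every state therefore lies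
  -- in `F`.
  set F : Finset S := {v | Relation.ReflTransGen (fun s s' => 0 < K s s') u v} with hFdef
  have hF : ∀ s ∈ F, ∀ s' ∉ F, ¬ 0 < K s s' := by
    intro a ha b hb hab
    simp only [hFdef, Finset.mem_filter_univ] at ha hb
    exact hb (ha.tail hab)
  have hmass := hK.sum_pushRow_of_closed x hF
  rw [hx, add_eq_left] at hmass
  have hKF (a : S) : 0 ≤ ∑ s' ∈ F, K a s' := Finset.sum_nonneg fun b _ => hK.nonneg a b
  rw [Finset.sum_eq_zero_iff_of_nonneg fun a _ => mul_nonneg (hx0 a) (hKF a)] at hmass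
  have key : 0 < x s → s ∈ F := by
    induction hu using Relation.ReflTransGen.head_induction_on with
    | refl => exact fun _ => by simp [hFdef, Relation.ReflTransGen.refl]
    | @head a c hac _ ih =>
      intro ha
      by_contra hna
      have hc : c ∈ F := ih (hK.pos_of_reflTransGen hx0 hx ha (.single hac))
        (hK.pos_of_reflTransGen hx0 hx ha (.single hac))
      have := hmass a (Finset.mem_compl.mpr hna)
      have hpos : 0 < ∑ s' ∈ F, K a s' := Finset.sum_pos' (fun b _ => hK.nonneg a b) ⟨c, hc, hac⟩
      exact (mul_pos ha hpos).ne' this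
  simpa [hFdef] using key hs

/-! ### The limiting distribution and the Poisson equation -/

variable {β x w : S → ℝ}

theorem limit_nonneg (hK : IsStochastic K) (hβ : ∀ s, 0 ≤ β s) (hx : pushRow K x = x)
    (hw : β - x = w - pushRow K w) (s : S) : 0 ≤ x s :=
  ge_of_tendsto' (hK.tendsto_average hx hw s) fun n =>
    mul_nonneg (by positivity) (Finset.sum_nonneg fun t _ => hK.pow_pushRow_nonneg hβ t s)

theorem sum_limit (hK : IsStochastic K) (hw : β - x = w - pushRow K w) :
    ∑ s, x s = ∑ s, β s := by
  have h : ∑ s, (β - x) s = ∑ s, (w - pushRow K w) s := by rw [hw]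
  simp only [Pi.sub_apply, Finset.sum_sub_distrib, hK.sum_pushRow] at h
  linarith

/-- The support of the limiting distribution is the union of the TSCCs. -/
theorem limit_pos_iff (hK : IsStochastic K) (hβ : ∀ s, 0 ≤ β s) (hx : pushRow K x = x)
    (hw : β - x = w - pushRow K w) (s : S) :
    0 < x s ↔ s ∈ tsccUnion (fun s s' => 0 < K s s') β := by
  classical
  have hx0 := hK.limit_nonneg hβ hx hw
  rw [mem_tsccUnion_iff]
  constructor
  · intro hs
    refine ⟨?_, fun u hu => hK.reflTransGen_symm_of_pos hx0 hx hs hu⟩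
    by_contra hne
    have hz (t : ℕ) : (pushRow K ^ t) β s = 0 :=
      le_antisymm (not_lt.mp fun h => hne (hK.reflTransGen_of_pow_pos hβ h))
        (hK.pow_pushRow_nonneg hβ t s)
    have := hK.tendsto_average hx hw s
    simp only [hz, Finset.sum_const_zero, mul_zero] at this
    exact hs.ne (tendsto_nhds_unique tendsto_const_nhds this)
  · rintro ⟨⟨s₀, h₀, hr⟩, hback⟩
    -- Once `s` is charged at time `t`, its closed orbit `F` never loses that mass, so `x` charges
    -- some `u ∈ F`; positivity then spreads from `u` back to `s`.
    obtain ⟨t, ht⟩ := hK.pow_pos_of_reflTransGen hβ h₀ hr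
    set F : Finset S := {v | Relation.ReflTransGen (fun s s' => 0 < K s s') s v} with hFdef
    have hF : ∀ s ∈ F, ∀ s' ∉ F, ¬ 0 < K s s' := by
      intro a ha b hb hab
      simp only [hFdef, Finset.mem_filter_univ] at ha hb
      exact hb (ha.tail hab)
    have hsF : s ∈ F := by simp [hFdef, Relation.ReflTransGen.refl]
    set v := (pushRow K ^ t) β with hvdef
    have hv0 : ∀ s, 0 ≤ v s := hK.pow_pushRow_nonneg hβ t
    -- Starting at time `t` keeps the limit `x` and replaces `w` by `wKᵗ`.
    have hvx : v - x = (pushRow K ^ t) w - pushRow K ((pushRow K ^ t) w) := by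
      have := congrArg (pushRow K ^ t) hw
      rwa [map_sub, map_sub, pow_pushRow_of_invariant hx, ← Module.End.mul_apply, ← pow_succ, pow_succ',
        Module.End.mul_apply] at this
    have hmono (k : ℕ) : v s ≤ ∑ a ∈ F, (pushRow K ^ k) v a := by
      induction k with
      | zero => exact Finset.single_le_sum (f := v) (fun a _ => hv0 a) hsF
      | succ k ih =>
        rw [pow_succ', Module.End.mul_apply,
          ← hK.sum_pushRow_of_closed _ hF]
        exact ih.trans (le_add_of_nonneg_right (Finset.sum_nonneg fun a _ =>
          mul_nonneg (hK.pow_pushRow_nonneg hv0 k a)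
            (Finset.sum_nonneg fun b _ => hK.nonneg a b)))
    have hlim := tendsto_finsetSum F fun a _ => hK.tendsto_average hx hvx a
    have hle : v s ≤ ∑ a ∈ F, x a := by
      refine ge_of_tendsto hlim ?_
      filter_upwards [eventually_gt_atTop 0] with n hn
      have hn' : (0 : ℝ) < n := by exact_mod_cast hn
      rw [← Finset.mul_sum, Finset.sum_comm, one_div, le_inv_mul_iff₀ hn']
      calc (n : ℝ) * v s = ∑ _k ∈ Finset.Icc 1 n, v s := by simp
        _ ≤ _ := Finset.sum_le_sum fun k _ => hmono k
    obtain ⟨u, huF, hu⟩ := Finset.exists_lt_of_sum_lt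
      (show ∑ _u ∈ F, (0 : ℝ) < ∑ a ∈ F, x a by
        rw [Finset.sum_const_zero]; exact ht.trans_le hle)
    simp only [hFdef, Finset.mem_filter_univ] at huF
    exact hK.pos_of_reflTransGen hx0 hx hu (hback u huF)

/-- The Poisson equation for the limiting distribution has a nonnegative solution. -/
theorem exists_nonneg_poisson (hK : IsStochastic K) (hβ : ∀ s, 0 ≤ β s) (hx : pushRow K x = x)
    (hw : β - x = w - pushRow K w) :
    ∃ y : S → ℝ, (∀ s, 0 ≤ y s) ∧ β - x = y - pushRow K y := by
  have hx0 := hK.limit_nonneg hβ hx hw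
  obtain ⟨z, w', hz, hw'⟩ := hK.exists_decomposition w
  -- Removing the invariant part of `w` makes the averages of `yKᵏ` tend to `0`.
  set y := w - z with hy
  have hyβ : β - x = y - pushRow K y := by
    rw [hw, hy, map_sub, hz]
    abel
  -- Off the support of `x`, the step from `yKᵏ` to `yKᵏ⁺¹` subtracts `βKᵏ ≥ 0`, so `y s` dominates
  -- averages that tend to `0`.
  have hzero (s : S) (hs : x s = 0) : 0 ≤ y s := by
    refine le_of_tendsto (hK.tendsto_average (v := y) (x := 0) (w := w') (by simp)
      (by rw [sub_zero]; exact hw') s) ?_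
    filter_upwards [eventually_gt_atTop 0] with n hn
    have hle (k : ℕ) : (pushRow K ^ k) y s ≤ y s := by
      induction k with
      | zero => rfl
      | succ k ih =>
        refine le_trans ?_ ih
        have h1 : pushRow K y = y - (β - x) := by rw [hyβ]; abel
        have := hK.pow_pushRow_nonneg hβ k s
        rw [pow_succ, Module.End.mul_apply, h1, map_sub (_ ^ k) y, map_sub (_ ^ k) β,
          pow_pushRow_of_invariant hx]
        simp only [Pi.sub_apply, hs]
        linarith
    have hn' : (0 : ℝ) < n := by exact_mod_cast hn
    rw [one_div, inv_mul_le_iff₀ hn']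
    calc _ ≤ ∑ _k ∈ Finset.Icc 1 n, y s := Finset.sum_le_sum fun k _ => hle k
      _ = n * y s := by simp
  -- On the support, a multiple of the invariant `x` lifts `y` above `0` without changing the
  -- equation.
  obtain ⟨c, hc⟩ : ∃ c : ℝ, ∀ s, 0 < x s → -y s / x s ≤ c := by
    obtain ⟨c, hc⟩ := (Set.finite_range fun s => -y s / x s).bddAbove
    exact ⟨c, fun s _ => hc ⟨s, rfl⟩⟩
  refine ⟨y + c • x, fun s => ?_, ?_⟩
  · rcases (hx0 s).eq_or_lt with hs | hs
    · simpa [← hs] using hzero s hs.symm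
    · have := (div_le_iff₀ hs).mp (hc s hs)
      simp only [Pi.add_apply, Pi.smul_apply, smul_eq_mul]
      linarith
  · rw [hyβ, map_add, map_smul, hx]
    abel

/-- A vector that is orthogonal to all harmonic functions is of the form `w - w K`. -/
theorem exists_poisson_of_orthogonal {v : S → ℝ}
    (hv : ∀ h : S → ℝ, (∀ s, ∑ s', K s s' * h s' = h s) → ∑ s, v s * h s = 0) :
    ∃ w, v = w - pushRow K w := by
  classical
  set f : (S → ℝ) →ₗ[ℝ] (S → ℝ) := 1 - pushRow K with hf
  suffices h : v ∈ LinearMap.range f by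
    obtain ⟨w, hw⟩ := h
    exact ⟨w, hw.symm⟩
  by_contra hn
  -- The functional `g` kills the range of `1 - K` but not `v`; its values on the basis vectors form
  -- a harmonic function.
  obtain ⟨g, hg, hle⟩ := Submodule.exists_le_ker_of_notMem hn
  have hexp (u : S → ℝ) : g u = ∑ s, u s * g (Pi.single s 1) := by
    conv_lhs => rw [pi_eq_sum_univ' u]
    simp [map_sum]
  refine hg ?_
  rw [hexp]
  refine hv _ fun s => ?_
  have h0 : g (f (Pi.single s 1)) = 0 := hle ⟨_, rfl⟩
  have h1 : pushRow K (Pi.single s 1) = K s := by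
    ext s'
    simp [pushRow_apply, Pi.single_apply]
  rw [hf, LinearMap.sub_apply, map_sub, Module.End.one_apply, h1, hexp (K s)] at h0
  linarith

end IsStochastic

namespace MDP

variable {S A : Type*} [Fintype S] (M : MDP S A)

/-! ## Stationary policies and their Markov chains -/

variable {M} {π : S → A → ℝ}

theorem isStochastic_inducedT (hπ : π ∈ M.stationaryPolicies) : IsStochastic (M.inducedT π) where
  nonneg s s' := Finset.sum_nonneg fun a ha => mul_nonneg (M.T_nonneg s a ha s') ((hπ s).1 a)
  sum_eq s := by
    simp only [inducedT]
    rw [Finset.sum_comm, ← (hπ s).2.2]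
    exact Finset.sum_congr rfl fun a ha => by rw [← Finset.sum_mul, M.T_sum s a ha, one_mul]

theorem stateProb_eq_pow (t : ℕ) : M.stateProb π t = (pushRow (M.inducedT π) ^ t) M.β := by
  induction t with
  | zero => rfl
  | succ t ih =>
    rw [pow_succ', Module.End.mul_apply, ← ih]
    rfl

theorem edge_of_inducedEdge (hπ : π ∈ M.stationaryPolicies) {s s' : S}
    (h : M.inducedEdge π s s') : M.Edge s s' := by
  obtain ⟨a, ha, h⟩ := Finset.exists_lt_of_sum_lt
    (show ∑ _a ∈ M.avail s, (0 : ℝ) < ∑ a ∈ M.avail s, M.T s a s' * π s a by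
      rw [Finset.sum_const_zero]; exact h)
  exact ⟨a, ha, pos_of_mul_pos_left h ((hπ s).1 a)⟩

theorem inducedEdge_of_pos (hπ : π ∈ M.stationaryPolicies) {s s' : S} {a : A} (ha : a ∈ M.avail s)
    (hT : 0 < M.T s a s') (hp : 0 < π s a) : M.inducedEdge π s s' :=
  Finset.sum_pos' (fun b hb => mul_nonneg (M.T_nonneg s b hb s') ((hπ s).1 b))
    ⟨a, ha, mul_pos hT hp⟩

/-- The recurrent set is closed under edges of `M`, so a path from it only uses edges that the
policy keeps. -/
theorem reflTransGen_inducedEdge_of_edge (hπ : π ∈ M.stationaryPolicies)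
    (hpos : ∀ s ∈ M.recurrentSet, ∀ a ∈ M.avail s, 0 < π s a) {s u : S} (hs : s ∈ M.recurrentSet)
    (hu : Relation.ReflTransGen M.Edge s u) : Relation.ReflTransGen (M.inducedEdge π) s u := by
  induction hu with
  | refl => exact .refl
  | @tail b c hb hbc ih =>
    obtain ⟨a, ha, hT⟩ := hbc
    exact ih.tail (inducedEdge_of_pos hπ ha hT
      (hpos b (mem_tsccUnion_of_reflTransGen hs hb) a ha))

/-- A policy that plays every action in the recurrent states of `M` keeps the recurrent classes
strongly connected. -/
theorem reflTransGen_inducedEdge_symm (hπ : π ∈ M.stationaryPolicies)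
    (hpos : ∀ s ∈ M.recurrentSet, ∀ a ∈ M.avail s, 0 < π s a) {s u : S} (hs : s ∈ M.recurrentSet)
    (hu : Relation.ReflTransGen (M.inducedEdge π) s u) :
    Relation.ReflTransGen (M.inducedEdge π) u s := by
  have hu' : Relation.ReflTransGen M.Edge s u :=
    Relation.ReflTransGen.mono (fun _ _ => edge_of_inducedEdge hπ) _ _ hu
  exact reflTransGen_inducedEdge_of_edge hπ hpos (mem_tsccUnion_of_reflTransGen hs hu')
    ((mem_tsccUnion_iff.mp hs).2 u hu')

/-! ### Limits of averages -/

variable {x w : S → ℝ}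

theorem isSteadyState_mul (hπ : π ∈ M.stationaryPolicies) (hx : pushRow (M.inducedT π) x = x)
    (hw : M.β - x = w - pushRow (M.inducedT π) w) : M.IsSteadyState π fun s a => x s * π s a := by
  intro s a _
  simp only [stateActionProb, stateProb_eq_pow, ← Finset.sum_mul, ← mul_assoc]
  exact ((isStochastic_inducedT hπ).tendsto_average hx hw s).mul_const _

theorem IsSteadyState.eq {p q : S → A → ℝ} (hp : M.IsSteadyState π p) (hq : M.IsSteadyState π q)
    {s : S} {a : A} (ha : a ∈ M.avail s) : p s a = q s a :=
  tendsto_nhds_unique (hp s a ha) (hq s a ha)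

theorem IsSteadyState.averageReward_eq {p : S → A → ℝ} (hp : M.IsSteadyState π p) :
    M.averageReward π = M.lpObjective p := by
  refine Tendsto.liminf_eq ?_
  have h := tendsto_finsetSum Finset.univ fun s _ => tendsto_finsetSum (M.avail s) fun a ha =>
    (hp s a ha).mul_const (M.meanReward s a)
  refine h.congr fun n => ?_
  simp only [expectedReward]
  rw [Finset.sum_comm, Finset.mul_sum]
  refine Finset.sum_congr rfl fun s _ => ?_
  rw [Finset.sum_comm, Finset.mul_sum]
  refine Finset.sum_congr rfl fun a _ => ?_
  rw [mul_assoc, Finset.sum_mul]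

theorem sum_avail_mul (hπ : π ∈ M.stationaryPolicies) (s : S) (c : ℝ) :
    ∑ a ∈ M.avail s, c * π s a = c := by
  rw [← Finset.mul_sum, (hπ s).2.2, mul_one]

theorem sum_avail_mul_T (v : S → ℝ) (s s' : S) :
    ∑ a ∈ M.avail s, v s * π s a * M.T s a s' = v s * M.inducedT π s s' := by
  rw [inducedT, Finset.mul_sum]
  exact Finset.sum_congr rfl fun a _ => by ring

theorem le_one_of_mem (hπ : π ∈ M.stationaryPolicies) {s : S} {a : A} (ha : a ∈ M.avail s) :
    π s a ≤ 1 :=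
  (Finset.single_le_sum (fun b _ => (hπ s).1 b) ha).trans_eq (hπ s).2.2

/-- The occupation measure of an edge-preserving policy satisfies the constraints. -/
theorem exists_isQ0_of_edgePreserving (hπ : π ∈ M.edgePreserving) :
    ∃ p y : S → A → ℝ, M.IsSteadyState π p ∧ M.IsQ0 p y ∧
      ∀ s ∈ M.recurrentSet, ∀ a ∈ M.avail s, 0 < p s a := by
  classical
  obtain ⟨hst, hr, hpos⟩ := hπ
  have hK := isStochastic_inducedT hst
  obtain ⟨x, w, hx, hw⟩ := hK.exists_decomposition M.β
  obtain ⟨y, hy0, hy⟩ := hK.exists_nonneg_poisson M.β_nonneg hx hw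
  have hx0 := hK.limit_nonneg M.β_nonneg hx hw
  -- Edge preservation turns the recurrent set of the chain into that of `M`.
  have hsupp : ∀ s, 0 < x s ↔ s ∈ M.recurrentSet := fun s => by
    rw [← hr]
    exact hK.limit_pos_iff M.β_nonneg hx hw s
  have hx1 (s : S) : x s ≤ 1 := by
    rw [← M.β_sum, ← hK.sum_limit hw]
    exact Finset.single_le_sum (fun u _ => hx0 u) (Finset.mem_univ s)
  refine ⟨fun s a => x s * π s a, fun s a => y s * π s a, isSteadyState_mul hst hx hw,
    ⟨fun s' => ?_, fun s' => ?_, ?_, fun s a ha => ⟨?_, ?_⟩, fun s a _ => ?_⟩, fun s hs a ha => ?_⟩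
  · simp only [sum_avail_mul_T, sum_avail_mul hst]
    exact congrFun hx s'
  · simp only [sum_avail_mul_T, sum_avail_mul hst, Finset.sum_add_distrib]
    have := congrFun hy s'
    simp only [Pi.sub_apply, pushRow_apply] at this
    linarith
  · refine Finset.sum_eq_zero fun f hf => ?_
    rw [sum_avail_mul hst]
    have hf' := (Finset.mem_filter.mp hf).2
    exact le_antisymm (not_lt.mp fun h => hf' ((hsupp f).mp h)) (hx0 f)
  · exact mul_nonneg (hx0 s) ((hst s).1 a)
  · exact mul_le_one₀ (hx1 s) ((hst s).1 a) (le_one_of_mem hst ha)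
  · exact mul_nonneg (hy0 s) ((hst s).1 a)
  · exact mul_pos ((hsupp s).mpr hs) (hpos s hs a ha)

/-! ### The policy derived from a solution of the linear program -/

variable {x y π₀ : S → A → ℝ}

theorem sum_avail_nonneg {z : S → A → ℝ} (hz : ∀ s, ∀ a ∈ M.avail s, 0 ≤ z s a) (s : S) :
    0 ≤ ∑ a ∈ M.avail s, z s a := Finset.sum_nonneg (hz s)

theorem mul_lpPolicy_of_pos {s : S} {a : A} (ha : a ∈ M.avail s)
    (hs : 0 < ∑ b ∈ M.avail s, x s b) :
    (∑ b ∈ M.avail s, x s b) * M.lpPolicy x y π₀ s a = x s a := by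
  rw [lpPolicy, if_pos ha, if_pos hs, mul_div_cancel₀ _ hs.ne']

theorem mul_lpPolicy_of_not_pos (hy : ∀ s, ∀ a ∈ M.avail s, 0 ≤ y s a) {s : S} {a : A}
    (ha : a ∈ M.avail s) (hs : ¬ 0 < ∑ b ∈ M.avail s, x s b) :
    (∑ b ∈ M.avail s, y s b) * M.lpPolicy x y π₀ s a = y s a := by
  rw [lpPolicy, if_pos ha, if_neg hs]
  split_ifs with h
  · rw [mul_div_cancel₀ _ h.ne']
  · have h0 := le_antisymm (not_lt.mp h) (sum_avail_nonneg hy s)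
    rw [h0, zero_mul, (Finset.sum_eq_zero_iff_of_nonneg (hy s)).mp h0 a ha]

/-- Where the total vanishes, nonnegativity makes each `x s a` vanish, so the arbitrary choice does
no harm. -/
theorem mul_lpPolicy (hx : ∀ s, ∀ a ∈ M.avail s, 0 ≤ x s a) {s : S} {a : A}
    (ha : a ∈ M.avail s) :
    (∑ b ∈ M.avail s, x s b) * M.lpPolicy x y π₀ s a = x s a := by
  by_cases hs : 0 < ∑ b ∈ M.avail s, x s b
  · exact mul_lpPolicy_of_pos ha hs
  · have h0 := le_antisymm (not_lt.mp hs) (sum_avail_nonneg hx s)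
    rw [h0, zero_mul, (Finset.sum_eq_zero_iff_of_nonneg (hx s)).mp h0 a ha]

theorem lpPolicy_mem_stationaryPolicies (hx : ∀ s, ∀ a ∈ M.avail s, 0 ≤ x s a)
    (hy : ∀ s, ∀ a ∈ M.avail s, 0 ≤ y s a) (hπ₀ : π₀ ∈ M.stationaryPolicies) :
    M.lpPolicy x y π₀ ∈ M.stationaryPolicies := by
  intro s
  refine ⟨fun a => ?_, fun a ha => by rw [lpPolicy, if_neg ha], ?_⟩
  · unfold lpPolicy
    split_ifs with ha h h'
    · exact div_nonneg (hx s a ha) h.le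
    · exact div_nonneg (hy s a ha) h'.le
    · exact (hπ₀ s).1 a
    · exact le_rfl
  · by_cases h : 0 < ∑ b ∈ M.avail s, x s b
    · have := Finset.sum_congr rfl fun a ha => mul_lpPolicy_of_pos (y := y) (π₀ := π₀) ha h
      rw [← Finset.mul_sum] at this
      exact mul_left_cancel₀ h.ne' (by rw [this, mul_one])
    · by_cases h' : 0 < ∑ b ∈ M.avail s, y s b
      · have := Finset.sum_congr rfl fun a ha =>
          mul_lpPolicy_of_not_pos (x := x) (π₀ := π₀) hy ha h
        rw [← Finset.mul_sum] at this
        exact mul_left_cancel₀ h'.ne' (by rw [this, mul_one])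
      · rw [← (hπ₀ s).2.2]
        exact Finset.sum_congr rfl fun a ha => by rw [lpPolicy, if_pos ha, if_neg h, if_neg h']

theorem stationaryPolicies_nonempty : M.stationaryPolicies.Nonempty := by
  classical
  choose f hf using M.avail_nonempty
  refine ⟨fun s a => if a = f s then 1 else 0, fun s => ⟨fun a => ?_, fun a ha => ?_, ?_⟩⟩
  · positivity
  · exact if_neg fun h : a = f s => ha (h ▸ hf s)
  · rw [Finset.sum_ite_eq', if_pos (hf s)]

/-- The policy derived from a solution is edge-preserving and has the solution as its steady
state. -/
theorem lpPolicy_edgePreserving (h : M.IsQ0 x y)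
    (hpos : ∀ s ∈ M.recurrentSet, ∀ a ∈ M.avail s, 0 < x s a) (hπ₀ : π₀ ∈ M.stationaryPolicies) :
    M.lpPolicy x y π₀ ∈ M.edgePreserving ∧ M.IsSteadyState (M.lpPolicy x y π₀) x := by
  classical
  have hx : ∀ s, ∀ a ∈ M.avail s, 0 ≤ x s a := fun s a ha => (h.x_mem s a ha).1
  have hst := lpPolicy_mem_stationaryPolicies hx h.y_nonneg hπ₀
  have hmul := fun s a (ha : a ∈ M.avail s) => mul_lpPolicy (y := y) (π₀ := π₀) hx ha
  have hmul' := fun s a (ha : a ∈ M.avail s) =>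
    mul_lpPolicy_of_not_pos (x := x) (π₀ := π₀) h.y_nonneg ha
  set π := M.lpPolicy x y π₀ with hπdef
  have hK := isStochastic_inducedT hst
  set X : S → ℝ := fun s => ∑ a ∈ M.avail s, x s a with hX
  have hsupp (s : S) : 0 < X s ↔ s ∈ M.recurrentSet := by
    refine ⟨fun hs => by_contra fun hn => hs.ne' ?_,
      fun hs => Finset.sum_pos (hpos s hs) (M.avail_nonempty s)⟩
    exact (Finset.sum_eq_zero_iff_of_nonneg fun f _ => sum_avail_nonneg hx f).mp h.transient s
      (Finset.mem_filter.mpr ⟨Finset.mem_univ s, hn⟩)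
  have hππ : ∀ s ∈ M.recurrentSet, ∀ a ∈ M.avail s, 0 < π s a := fun s hs a ha =>
    pos_of_mul_pos_right (by rw [hmul s a ha]; exact hpos s hs a ha) ((hsupp s).mpr hs).le
  have hinv : pushRow (M.inducedT π) X = X := by
    ext s'
    rw [pushRow_apply, hX]
    simp only
    rw [← h.stationary s']
    refine Finset.sum_congr rfl fun s _ => ?_
    rw [← sum_avail_mul_T X]
    exact Finset.sum_congr rfl fun a ha => by rw [hmul s a ha]
  obtain ⟨w, hw⟩ : ∃ w, M.β - X = w - pushRow (M.inducedT π) w := by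
    refine IsStochastic.exists_poisson_of_orthogonal fun g hg => ?_
    -- Every action in a recurrent state stays in its class, where `g` is constant.
    have hterm (s : S) (a : A) (ha : a ∈ M.avail s) (hs : s ∈ M.recurrentSet) :
        ∑ s', M.T s a s' * g s' = g s := by
      rw [← one_mul (g s), ← M.T_sum s a ha, Finset.sum_mul]
      refine Finset.sum_congr rfl fun s' _ => ?_
      rcases (M.T_nonneg s a ha s').eq_or_lt with hz | hT
      · rw [← hz, zero_mul, zero_mul]
      · rw [hK.harmonic_eq hg (fun u hu => reflTransGen_inducedEdge_symm hst hππ hs hu)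
          (.single (inducedEdge_of_pos hst ha hT (hππ s hs a ha)))]
    -- On recurrent states any distribution of `y` over actions works; elsewhere `y` is distributed
    -- according to `π` and `g` is harmonic for `π`.
    have hstate (s : S) :
        ∑ a ∈ M.avail s, y s a * ∑ s', M.T s a s' * g s' = (∑ a ∈ M.avail s, y s a) * g s := by
      by_cases hs : 0 < X s
      · rw [Finset.sum_mul]
        exact Finset.sum_congr rfl fun a ha => by rw [hterm s a ha ((hsupp s).mp hs)]
      · calc ∑ a ∈ M.avail s, y s a * ∑ s', M.T s a s' * g s'
            = ∑ a ∈ M.avail s, ∑ s',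
                (∑ b ∈ M.avail s, y s b) * π s a * M.T s a s' * g s' := by
              refine Finset.sum_congr rfl fun a ha => ?_
              rw [hmul' s a ha hs, Finset.mul_sum]
              exact Finset.sum_congr rfl fun s' _ => (mul_assoc _ _ _).symm
          _ = ∑ s', (∑ b ∈ M.avail s, y s b) * (M.inducedT π s s' * g s') := by
              rw [Finset.sum_comm]
              refine Finset.sum_congr rfl fun s' _ => ?_
              rw [← Finset.sum_mul,
                sum_avail_mul_T (fun s => ∑ b ∈ M.avail s, y s b), mul_assoc]
          _ = _ := by rw [← Finset.mul_sum, hg]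
    have hflow (s' : S) : (M.β - X) s' =
        ∑ a ∈ M.avail s', y s' a - ∑ s, ∑ a ∈ M.avail s, y s a * M.T s a s' := by
      rw [h.flow s', Finset.sum_add_distrib, Pi.sub_apply]
      ring
    simp only [hflow, sub_mul, Finset.sum_sub_distrib]
    rw [sub_eq_zero, ← Finset.sum_congr rfl fun s _ => hstate s]
    simp only [Finset.sum_mul, Finset.mul_sum]
    rw [Finset.sum_comm (s := Finset.univ (α := S)) (t := Finset.univ (α := S))]
    refine (Finset.sum_congr rfl fun s _ => ?_)
    rw [Finset.sum_comm]
    exact Finset.sum_congr rfl fun s' _ => Finset.sum_congr rfl fun a _ => (mul_assoc _ _ _).symm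
  refine ⟨⟨hst, ?_, hππ⟩, fun s a ha => ?_⟩
  · ext s
    rw [← hsupp s]
    exact (hK.limit_pos_iff M.β_nonneg hinv hw s).symm
  · rw [← hmul s a ha]
    exact isSteadyState_mul hst hinv hw s a ha

end MDP

namespace LMDP

variable {S A : Type*} [Fintype S] {M : LMDP S A}

/-- Edge-preserving policies that meet the specifications give feasible solutions. -/
theorem exists_isLP1Feasible {π : S → A → ℝ} (hπ : π ∈ M.edgePreserving) (hs : M.MeetsSpecs π) :
    ∃ x y, M.IsLP1Feasible x y ∧ M.IsSteadyState π x := by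
  obtain ⟨x, y, hx, hq, hpos⟩ := MDP.exists_isQ0_of_edgePreserving hπ
  obtain ⟨p, hp, hspec⟩ := hs
  refine ⟨x, y, ⟨hq, fun i => ?_, hpos⟩, hx⟩
  have : ∑ s ∈ M.label i, ∑ a ∈ M.avail s, x s a = ∑ s ∈ M.label i, ∑ a ∈ M.avail s, p s a :=
    Finset.sum_congr rfl fun s _ => Finset.sum_congr rfl fun a ha => hx.eq hp ha
  rw [this]
  exact hspec i

end LMDP

theorem mainTheorem1 {S A : Type*} [Fintype S] (M : LMDP S A) :
    ((∃ x y : S → A → ℝ, M.IsLP1Feasible x y) ↔ ∃ π ∈ M.edgePreserving, M.MeetsSpecs π) ∧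
    ∀ x y : S → A → ℝ, M.IsLP1Optimal x y → ∀ π₀ ∈ M.stationaryPolicies,
      M.lpPolicy x y π₀ ∈ M.edgePreserving ∧
      M.MeetsSpecs (M.lpPolicy x y π₀) ∧
      ∀ π ∈ M.edgePreserving, M.MeetsSpecs π →
        M.averageReward π ≤ M.averageReward (M.lpPolicy x y π₀) := by
  refine ⟨⟨?_, ?_⟩, ?_⟩
  · rintro ⟨x, y, h⟩
    obtain ⟨π₀, hπ₀⟩ := M.stationaryPolicies_nonempty
    obtain ⟨hep, hss⟩ := MDP.lpPolicy_edgePreserving h.q0 h.pos hπ₀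
    exact ⟨_, hep, x, hss, h.specs⟩
  · rintro ⟨π, hπ, hs⟩
    obtain ⟨x, y, h, -⟩ := LMDP.exists_isLP1Feasible hπ hs
    exact ⟨x, y, h⟩
  · rintro x y ⟨h, hopt⟩ π₀ hπ₀
    obtain ⟨hep, hss⟩ := MDP.lpPolicy_edgePreserving h.q0 h.pos hπ₀
    refine ⟨hep, ⟨x, hss, h.specs⟩, fun π hπ hs => ?_⟩
    obtain ⟨x', y', h', hx'⟩ := LMDP.exists_isLP1Feasible hπ hs
    -- Both average rewards are objective values of feasible points.
    rw [hss.averageReward_eq, hx'.averageReward_eq]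
    exact hopt x' y' h'
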